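/- Let $N\ge 0$ and, for $h=1,\dots,N$, let $\mu_h,\beta_h\in\mathbb R$, $a_h\ge 0$, $\alpha_h\in(0,2]\setminus\{1\}$, $\lambda_{+,h},\lambda_{-,h}>0$. For $\alpha\in(0,2)$ and $\lambda_+,\lambda_->0$, the standardized classical tempered stable law $\mathrm{stdCTS}(\alpha,\lambda_+,\lambda_-)$ is the centred infinitely divisible law on $\mathbb R$ without Gaussian part whose Lévy measure has density $$C\Big(\frac{e^{-\lambda_+x}}{x^{1+\alpha}}\mathbf 1_{x>0}+\frac{e^{-\lambda_-|x|}}{|x|^{1+\alpha}}\mathbf 1_{x<0}\Big),\qquad C=\frac1{\Gamma(2-\alpha)\,(\lambda_+^{\alpha-2}+\lambda_-^{\alpha-2})},$$ that is, its characteristic function is $u\mapsto\exp\int(e^{iux}-1-iux)\,\nu(dx)$, where $\nu$ is this Lévy measure. For $\alpha=2$ it is the standard normal law. On a probability space let $G_1,\dots,G_N,Z$ be mutually independent, infinitely divisible random variables with values in $[0,\infty)$, and put $V_h=G_h+a_hZ$. Let $X_1,\dots,X_N$ be real random variables that are conditionally independent given $\chi=\sigma(G_1,\dots,G_N,Z)$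 and such that, for each $h$, almost surely on $\{V_h>0\}$ the conditional law of $X_h$ given $\chi$ is $\mathrm{stdCTS}(\alpha_h,\lambda_{+,h}\sqrt{V_h},\lambda_{-,h}\sqrt{V_h})$. The multivariate MixedTS vector $Y=(Y_1,\dots,Y_N)$ is given by $$Y_h=\mu_h+\beta_hV_h+\sqrt{V_h}\,X_h .$$ For a random variable $W$ write $\Phi_W(z)=\log E[e^{zW}]$ for $z\in\mathbb C$ (where $E[e^{zW}]$ exists and is nonzero; the choice of the branch does not matter below), and let, with principal values of the powers, $$L_{stdCTS}(u;\lambda_+,\lambda_-,\alpha)=\frac{(\lambda_+-iu)^{\alpha}-\lambda_+^{\alpha}+(\lambda_-+iu)^{\alpha}-\lambda_-^{\alpha}}{\alpha(\alpha-1)(\lambda_+^{\alpha-2}+\lambda_-^{\alpha-2})}+\frac{iu(\lambda_+^{\alpha-1}-\lambda_-^{\alpha-1})}{(\alpha-1)(\lambda_+^{\alpha-2}+\lambda_-^{\alpha-2})}.$$ Then $L_{stdCTS}$ is the characteristic exponent of the standardized CTS law: for each $h$, $\mathrm{stdCTS}(\alpha_h,\lambda_{+,h},\lambda_{-,h})$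 has characteristic function $t\mapsto\exp L_{stdCTS}(t;\lambda_{+,h},\lambda_{-,h},\alpha_h)$. Moreover, for every $u\in\mathbb R^N$, with $L_h=L_{stdCTS}(u_h;\lambda_{+,h},\lambda_{-,h},\alpha_h)$, $$E\big[e^{i\langle u,Y\rangle}\big]=e^{i\sum_{h=1}^Nu_h\mu_h}\;e^{\Phi_Z\left(\sum_{h=1}^N(i\,a_hu_h\beta_h+a_hL_h)\right)}\;\prod_{h=1}^Ne^{\Phi_{G_h}\left(i\,u_h\beta_h+L_h\right)},$$ where the expectations $E[e^{zZ}]$ and $E[e^{zG_h}]$ that define $\Phi_Z$ and $\Phi_{G_h}$ exist and are nonzero at the points $z$ at which they are evaluated. -/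

import Mathlib

open MeasureTheory ProbabilityTheory

/-- A law on `ℝ` is infinitely divisible: for every `n ≥ 1` it is the law of a sum of `n`
independent copies of some random variable. -/
def IsInfinitelyDivisible (ρ : Measure ℝ) : Prop :=
  ∀ n : ℕ, 1 ≤ n → ∃ ν : Measure ℝ, IsProbabilityMeasure ν ∧
    ρ = (Measure.pi (fun _ : Fin n => ν)).map (fun x => ∑ i, x i)

/-- The normalising constant `1 / (Γ(2 - α) (λ₊ ^ (α - 2) + λ₋ ^ (α - 2)))`, for which the law with
the Lévy density below has unit variance. -/
noncomputable def stdCTSConst (α lp lm : ℝ) : ℝ :=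
  1 / (Real.Gamma (2 - α) * (lp ^ (α - 2) + lm ^ (α - 2)))

/-- The Lévy density of the standardized classical tempered stable law (`0 < α < 2`). -/
noncomputable def stdCTSLevyDensity (α lp lm x : ℝ) : ℝ :=
  if 0 < x then stdCTSConst α lp lm * Real.exp (-lp * x) / x ^ (1 + α)
  else if x < 0 then stdCTSConst α lp lm * Real.exp (-lm * |x|) / |x| ^ (1 + α)
  else 0

/-- The Lévy measure of the standardized classical tempered stable law (`0 < α < 2`). -/
noncomputable def stdCTSLevyMeasure (α lp lm : ℝ) : Measure ℝ :=
  volume.withDensity (fun x => ENNReal.ofReal (stdCTSLevyDensity α lp lm x))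

/-- `ρ` is the standardized classical tempered stable law `stdCTS(α, λ₊, λ₋)`, for `0 < α ≤ 2` and
`λ₊, λ₋ > 0`. For `α < 2` it is the centred, purely non-Gaussian infinitely divisible law with the
Lévy measure above (Lévy-Khintchine formula with compensator `x`); for `α = 2` it is the standard
normal law. -/
def IsStdCTS (α lp lm : ℝ) (ρ : Measure ℝ) : Prop :=
  IsProbabilityMeasure ρ ∧
  (α < 2 → ∀ u : ℝ, charFun ρ u =
    Complex.exp (∫ x, (Complex.exp (Complex.I * u * x) - 1 - Complex.I * u * x)
      ∂(stdCTSLevyMeasure α lp lm))) ∧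
  (α = 2 → ρ = gaussianReal 0 1)

/-- The closed-form exponent `L_stdCTS(u; λ₊, λ₋, α)` (complex powers are principal values). -/
noncomputable def stdCTSExponent (u lp lm α : ℝ) : ℂ :=
  ((lp - Complex.I * u : ℂ) ^ (α : ℂ) - (lp : ℂ) ^ (α : ℂ)
      + (lm + Complex.I * u : ℂ) ^ (α : ℂ) - (lm : ℂ) ^ (α : ℂ))
    / (α * (α - 1) * ((lp : ℂ) ^ ((α : ℂ) - 2) + (lm : ℂ) ^ ((α : ℂ) - 2)))
  + Complex.I * u * ((lp : ℂ) ^ ((α : ℂ) - 1) - (lm : ℂ) ^ ((α : ℂ) - 1))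
    / ((α - 1) * ((lp : ℂ) ^ ((α : ℂ) - 2) + (lm : ℂ) ^ ((α : ℂ) - 2)))

/-- `Φ_V(z) = log E[exp(z V)]` at a complex argument `z`. -/
noncomputable def logMGF {Ω : Type*} [MeasurableSpace Ω] (P : Measure Ω) (V : Ω → ℝ) (z : ℂ) : ℂ :=
  Complex.log (complexMGF V P z)

/-- `Y` is a multivariate MixedTS random vector with parameters `μ, β, a, α, λ₊, λ₋`, built from the
non-negative infinitely divisible variables `G₁, …, G_N, Z` and the variables `X₁, …, X_N`. -/
structure IsMultivariateMixedTS {Ω : Type*} [MeasurableSpace Ω] (P : Measure Ω)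
    [IsProbabilityMeasure P] {N : ℕ} (μ β a α lp lm : Fin N → ℝ)
    (G : Fin N → Ω → ℝ) (Z : Ω → ℝ) (X : Fin N → Ω → ℝ)
    (Y : Ω → EuclideanSpace ℝ (Fin N)) : Prop where
  a_nonneg : ∀ i, 0 ≤ a i
  alpha_pos : ∀ i, 0 < α i
  alpha_le_two : ∀ i, α i ≤ 2
  lp_pos : ∀ i, 0 < lp i
  lm_pos : ∀ i, 0 < lm i
  measurable_G : ∀ i, Measurable (G i)
  measurable_Z : Measurable Z
  measurable_X : ∀ i, Measurable (X i)
  G_nonneg : ∀ i, ∀ᵐ ω ∂P, 0 ≤ G i ω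
  Z_nonneg : ∀ᵐ ω ∂P, 0 ≤ Z ω
  G_infDiv : ∀ i, IsInfinitelyDivisible (P.map (G i))
  Z_infDiv : IsInfinitelyDivisible (P.map Z)
  /-- `G₁, …, G_N, Z` are mutually independent. -/
  indep : iIndepFun (fun j : Option (Fin N) => j.elim Z G) P
  /-- Given `χ = σ(G₁, …, G_N, Z)`, the variables `X₁, …, X_N` are independent. -/
  cond_indep : ∀ᵐ ω ∂P, iIndepFun (fun (i : Fin N) (x : Fin N → ℝ) => x i)
    (condDistrib (fun ω i => X i ω) (fun ω => ((fun i => G i ω), Z ω)) P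
      ((fun i => G i ω), Z ω))
  /-- Given `χ`, the law of `X i` is `stdCTS(α i, λ₊ i √(V i), λ₋ i √(V i))`, where
  `V i = G i + a i Z`. Nothing is required where `V i = 0`, since `X i` does not enter `Y` there. -/
  cond_law : ∀ i, ∀ᵐ ω ∂P, 0 < G i ω + a i * Z ω →
    IsStdCTS (α i) (lp i * √(G i ω + a i * Z ω)) (lm i * √(G i ω + a i * Z ω))
      ((condDistrib (fun ω i => X i ω) (fun ω => ((fun i => G i ω), Z ω)) P
        ((fun i => G i ω), Z ω)).map (fun x => x i))
  Y_eq : ∀ᵐ ω ∂P, ∀ i, Y ω i =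
    μ i + β i * (G i ω + a i * Z ω) + √(G i ω + a i * Z ω) * X i ω

/-! Condition on the mixing variables. The exponent is homogeneous of degree two under joint scaling
of `u`, `lp`, `lm` (`stdCTSExponent_mul`), so the tempering rates scaled by `√V` turn the
conditional characteristic function of `√V * X` into `exp (V * L)`. Conditional independence
multiplies these factors, and what remains is the exponential of a linear form in the independent `G
h` and `Z` (`integral_cexp_sum_eq_prod`).

That `L` is the characteristic exponent comes from computing the Lévy-Khintchine integral
(`integral_stdCTSLevyMeasure`). Its integrand has real part `cos - 1 ≤ 0`, so all arguments of the
transforms have nonpositive real part and the expectations exist. They are nonzero because an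
infinitely divisible law on the half-line has convolution roots whose transforms are close to one
(`IsInfinitelyDivisible.complexMGF_id_ne_zero`). -/

/-! ### The Lévy-Khintchine integral in closed form -/

/-- The Gamma integral with a complex rate. -/
theorem integral_rpow_mul_cexp_neg_mul_Ioi {s : ℝ} (hs : 0 < s) {z : ℂ} (hz : 0 < z.re) :
    ∫ x in Set.Ioi (0 : ℝ), ((x ^ (s - 1) : ℝ) : ℂ) * Complex.exp (-z * x)
      = Real.Gamma s * z ^ (-s : ℂ) := by
  -- Both sides are analytic in `w = -z` on the left half-plane, the integral being a `complexMGF`;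
  -- the identity theorem extends the classical formula from real rates.
  set m : Measure ℝ := (volume.restrict (Set.Ioi (0 : ℝ))).withDensity
    (fun x => ENNReal.ofReal (x ^ (s - 1))) with hm
  have hmeas : Measurable (fun x : ℝ => ENNReal.ofReal (x ^ (s - 1))) := by fun_prop
  have hmgf (w : ℂ) : complexMGF id m w
      = ∫ x in Set.Ioi (0 : ℝ), ((x ^ (s - 1) : ℝ) : ℂ) * Complex.exp (w * x) := by
    rw [complexMGF, hm, integral_withDensity_eq_integral_toReal_smul hmeas (by simp)]
    refine setIntegral_congr_fun measurableSet_Ioi fun x hx => ?_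
    simp [ENNReal.toReal_ofReal (Real.rpow_nonneg (le_of_lt hx) _)]
  have hset : Set.Iio (0 : ℝ) ⊆ integrableExpSet id m := by
    intro t ht
    have ht' : t < 0 := ht
    rw [integrableExpSet, Set.mem_ofPred_eq, hm,
      integrable_withDensity_iff_integrable_smul' hmeas (by simp)]
    have := integrableOn_rpow_mul_exp_neg_mul_rpow (s := s - 1) (p := 1) (b := -t)
      (by linarith) one_pos (by linarith)
    refine this.congr_fun (fun x hx => ?_) measurableSet_Ioi
    simp [ENNReal.toReal_ofReal (Real.rpow_nonneg (le_of_lt hx) _)]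
  have hU : IsOpen {w : ℂ | w.re < 0} := isOpen_lt Complex.continuous_re continuous_const
  have hUc : IsPreconnected {w : ℂ | w.re < 0} := (convex_halfSpace_re_lt 0).isPreconnected
  have hf : AnalyticOnNhd ℂ (complexMGF id m) {w : ℂ | w.re < 0} := fun w hw =>
    analyticAt_complexMGF (interior_mono hset (by simpa [isOpen_Iio.interior_eq] using hw))
  have hg : AnalyticOnNhd ℂ (fun w : ℂ => (Real.Gamma s : ℂ) * (-w) ^ (-s : ℂ))
      {w : ℂ | w.re < 0} := by
    intro w hw
    refine analyticAt_const.mul (analyticAt_id.neg.cpow analyticAt_const ?_)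
    left
    simpa using hw
  have hreal (r : ℝ) (hr : 0 < r) :
      complexMGF id m (-r : ℝ) = (Real.Gamma s : ℂ) * (-(-r : ℝ)) ^ (-s : ℂ) := by
    have := Complex.integral_cpow_mul_exp_neg_mul_Ioi (a := s) (r := r) (by simpa) hr
    rw [hmgf]
    rw [Complex.Gamma_ofReal, one_div, Complex.inv_cpow _ _ (by
      rw [Complex.arg_ofReal_of_nonneg hr.le]; exact Real.pi_pos.ne), ← Complex.cpow_neg] at this
    rw [show (-((-r : ℝ) : ℂ)) = r by push_cast; ring, mul_comm (Real.Gamma s : ℂ), ← this]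
    refine setIntegral_congr_fun measurableSet_Ioi fun x hx => ?_
    rw [Complex.ofReal_cpow (le_of_lt hx)]
    push_cast
    ring_nf
  have hfreq : ∃ᶠ w in nhdsWithin (-1 : ℂ) {-1}ᶜ,
      complexMGF id m w = (Real.Gamma s : ℂ) * (-w) ^ (-s : ℂ) := by
    -- Real points different from `-1` that accumulate there.
    have ht : Filter.Tendsto (fun n : ℕ => (((-(1 + 1 / ((n : ℝ) + 1)) : ℝ)) : ℂ)) Filter.atTop
        (nhdsWithin (-1 : ℂ) {-1}ᶜ) := by
      refine tendsto_nhdsWithin_iff.2 ⟨?_, Filter.Eventually.of_forall fun n => ?_⟩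
      · have h0 := tendsto_one_div_add_atTop_nhds_zero_nat (𝕜 := ℝ)
        have h1 := ((h0.const_add 1).neg)
        have h2 := (Complex.continuous_ofReal.tendsto _).comp h1
        simpa [Function.comp_def] using h2
      · have : (0 : ℝ) < 1 / ((n : ℝ) + 1) := by positivity
        simp only [Set.mem_compl_iff, Set.mem_singleton_iff]
        intro h
        have h' : -(1 + 1 / ((n : ℝ) + 1)) = -1 := by exact_mod_cast h
        linarith
    refine ht.frequently (Filter.Frequently.of_forall fun n => ?_)
    exact hreal _ (by positivity)
  have h := hf.eqOn_of_preconnected_of_frequently_eq hg hUc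
    (show (-1 : ℂ) ∈ {w : ℂ | w.re < 0} by simp) hfreq
    (show -z ∈ {w : ℂ | w.re < 0} by simpa using hz)
  rw [hmgf] at h
  simpa using h

/-- Taylor's remainder. The factor `y ^ 2` lowers the singularity `x ^ (-1 - α)` of the Lévy density
to `x ^ (1 - α)`, integrable at zero for every `α < 2`, so `α < 1` and `α > 1` need no separate
treatment. -/
theorem cexp_sub_one_sub_eq_integral (y : ℂ) :
    Complex.exp y - 1 - y = ∫ t in (0 : ℝ)..1, y ^ 2 * ((1 - t) * Complex.exp (t * y)) := by
  have hd (t : ℝ) : HasDerivAt (fun t : ℝ => Complex.exp (t * y) + (1 - t) * y * Complex.exp (t * y))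
      (y ^ 2 * ((1 - t) * Complex.exp (t * y))) t := by
    have h1 : HasDerivAt (fun t : ℝ => (t : ℂ)) 1 t := Complex.ofRealCLM.hasDerivAt
    have h2 : HasDerivAt (fun t : ℝ => Complex.exp (t * y)) _ t := (h1.mul_const y).cexp
    convert! h2.add (((h1.const_sub 1).mul_const y).mul h2) using 1
    ring
  rw [intervalIntegral.integral_eq_sub_of_hasDerivAt (fun t _ => hd t)
    (Continuous.intervalIntegrable (by fun_prop) _ _)]
  simp
  ring

theorem integral_one_sub_mul_cpow {α l u : ℝ} (h0 : α ≠ 0) (h1 : α ≠ 1) (hl : 0 < l) :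
    ∫ t in (0 : ℝ)..1, (Complex.I * u) ^ 2 * ((1 - t) * (l - Complex.I * u * t) ^ ((α : ℂ) - 2))
      = ((l - Complex.I * u) ^ (α : ℂ) - (l : ℂ) ^ (α : ℂ)
          + Complex.I * u * α * (l : ℂ) ^ ((α : ℂ) - 1)) / (α * (α - 1)) := by
  have h0' : (α : ℂ) ≠ 0 := by exact_mod_cast h0
  have h1' : (α : ℂ) - 1 ≠ 0 := sub_ne_zero.2 (by exact_mod_cast h1)
  have hs (t : ℝ) : (l - Complex.I * u * t : ℂ) ∈ Complex.slitPlane := by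
    left; simpa using hl
  -- This antiderivative comes from integrating by parts, differentiating `1 - t`.
  have hd (t : ℝ) : HasDerivAt (fun t : ℝ => ((l - Complex.I * u * t : ℂ) ^ (α : ℂ)
        - Complex.I * u * α * (1 - t) * (l - Complex.I * u * t : ℂ) ^ ((α : ℂ) - 1)) /
          (α * (α - 1)))
      ((Complex.I * u) ^ 2 * ((1 - t) * (l - Complex.I * u * t) ^ ((α : ℂ) - 2))) t := by
    have h1 : HasDerivAt (fun t : ℝ => (t : ℂ)) 1 t := Complex.ofRealCLM.hasDerivAt
    have hb : HasDerivAt (fun t : ℝ => (l - Complex.I * u * t : ℂ)) _ t :=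
      (h1.const_mul (Complex.I * u)).const_sub (l : ℂ)
    have hp (c : ℂ) := (Complex.hasStrictDerivAt_cpow_const (c := c) (hs t)).hasDerivAt.comp t hb
    convert! ((hp α).sub ((((h1.const_sub 1).const_mul (Complex.I * u * α))).mul
      (hp (α - 1)))).div_const ((α : ℂ) * (α - 1)) using 1
    rw [show (α : ℂ) - 1 - 1 = α - 2 by ring, eq_div_iff (mul_ne_zero h0' h1')]
    simp only [Function.comp_apply]
    ring
  rw [intervalIntegral.integral_eq_sub_of_hasDerivAt (fun t _ => hd t)]
  · simp
    ring
  · refine Continuous.intervalIntegrable ?_ _ _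
    refine continuous_const.mul (Continuous.mul (by fun_prop) ?_)
    exact Continuous.cpow (by fun_prop) continuous_const hs

/-- Insert Taylor's remainder and exchange the integrals: the `x`-integral is a Gamma integral with
`s = 2 - α` and rate `l - Complex.I * u * t`. -/
theorem integral_tempered_stable_Ioi {α l : ℝ} (h0 : 0 < α) (h1 : α ≠ 1) (h2 : α < 2)
    (hl : 0 < l) (u : ℝ) :
    IntegrableOn (fun x : ℝ => ((Real.exp (-l * x) / x ^ (1 + α) : ℝ) : ℂ) *
      (Complex.exp (Complex.I * u * x) - 1 - Complex.I * u * x)) (Set.Ioi 0) ∧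
    ∫ x in Set.Ioi (0 : ℝ), ((Real.exp (-l * x) / x ^ (1 + α) : ℝ) : ℂ) *
      (Complex.exp (Complex.I * u * x) - 1 - Complex.I * u * x)
      = Real.Gamma (2 - α) * (((l - Complex.I * u) ^ (α : ℂ) - (l : ℂ) ^ (α : ℂ)
          + Complex.I * u * α * (l : ℂ) ^ ((α : ℂ) - 1)) / (α * (α - 1))) := by
  set F : ℝ → ℝ → ℂ := fun t x => ((Complex.I * u) ^ 2 * (1 - t)) *
    (((x ^ (2 - α - 1) : ℝ) : ℂ) * Complex.exp (-(l - Complex.I * u * t) * x)) with hF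
  have hfF : ∀ x ∈ Set.Ioi (0 : ℝ), ∫ t in (0 : ℝ)..1, F t x
      = ((Real.exp (-l * x) / x ^ (1 + α) : ℝ) : ℂ) *
      (Complex.exp (Complex.I * u * x) - 1 - Complex.I * u * x) := by
    intro x hx
    have hx0 : (0 : ℝ) < x := hx
    rw [cexp_sub_one_sub_eq_integral, ← intervalIntegral.integral_const_mul]
    refine intervalIntegral.integral_congr fun t _ => ?_
    have hpow : x ^ (2 - α - 1) = x ^ 2 / x ^ (1 + α) := by
      rw [← Real.rpow_natCast, ← Real.rpow_sub hx0]
      congr 1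
      push_cast
      ring
    have hexp : Complex.exp (-(l - Complex.I * u * t) * x)
        = Complex.exp (-l * x) * Complex.exp (t * (Complex.I * u * x)) := by
      rw [← Complex.exp_add]
      congr 1
      ring
    simp only [hF, hpow, hexp]
    push_cast
    ring
  have hF_int : Integrable (Function.uncurry F)
      ((volume.restrict (Set.uIoc (0 : ℝ) 1)).prod (volume.restrict (Set.Ioi (0 : ℝ)))) := by
    have hA : Integrable (fun t : ℝ => (Complex.I * u) ^ 2 * (1 - t))
        (volume.restrict (Set.uIoc (0 : ℝ) 1)) := by
      rw [← IntegrableOn, ← intervalIntegrable_iff]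
      exact Continuous.intervalIntegrable (by fun_prop) _ _
    have hB : Integrable (fun x : ℝ => x ^ (2 - α - 1) * Real.exp (-l * x))
        (volume.restrict (Set.Ioi (0 : ℝ))) := by
      simpa [IntegrableOn] using integrableOn_rpow_mul_exp_neg_mul_rpow (s := 2 - α - 1) (p := 1) (b := l)
        (by linarith) one_pos hl
    -- The imaginary part of the rate does not affect the norm, so a product function dominates.
    refine (hA.mul_prod hB.ofReal).mono (by fun_prop) (Filter.Eventually.of_forall fun p => ?_)
    simp [hF, Function.uncurry, Complex.norm_exp]
  have hswap := intervalIntegral_integral_swap hF_int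
  have hinner (t : ℝ) : ∫ x in Set.Ioi (0 : ℝ), F t x
      = Real.Gamma (2 - α) * ((Complex.I * u) ^ 2 *
        ((1 - t) * (l - Complex.I * u * t) ^ ((α : ℂ) - 2))) := by
    simp only [hF]
    rw [integral_const_mul, integral_rpow_mul_cexp_neg_mul_Ioi (by linarith) (by simpa)]
    push_cast
    ring_nf
  constructor
  · have h := hF_int.integral_prod_right
    rw [Set.uIoc_of_le zero_le_one] at h
    refine IntegrableOn.congr_fun h (fun x hx => ?_) measurableSet_Ioi
    rw [← hfF x hx, intervalIntegral.integral_of_le zero_le_one]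
    rfl
  · rw [← setIntegral_congr_fun measurableSet_Ioi hfF, ← hswap]
    simp_rw [hinner]
    rw [intervalIntegral.integral_const_mul, integral_one_sub_mul_cpow h0.ne' h1 hl]

theorem stdCTSExponent_two (u lp lm : ℝ) : stdCTSExponent u lp lm 2 = -(u : ℂ) ^ 2 / 2 := by
  simp only [stdCTSExponent, Complex.ofReal_ofNat, sub_self, Complex.cpow_zero, Complex.cpow_ofNat,
    show (2 : ℂ) - 1 = 1 by norm_num, Complex.cpow_one]
  linear_combination (u : ℂ) ^ 2 / 2 * Complex.I_sq

theorem integral_stdCTSLevyMeasure {α lp lm : ℝ} (h0 : 0 < α) (h1 : α ≠ 1) (h2 : α < 2)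
    (hlp : 0 < lp) (hlm : 0 < lm) (u : ℝ) :
    ∫ x, (Complex.exp (Complex.I * u * x) - 1 - Complex.I * u * x) ∂(stdCTSLevyMeasure α lp lm)
      = stdCTSExponent u lp lm α := by
  have hΓ : 0 < Real.Gamma (2 - α) := Real.Gamma_pos_of_pos (by linarith)
  have hS : 0 < lp ^ (α - 2) + lm ^ (α - 2) := by positivity
  have hC : 0 < stdCTSConst α lp lm := by unfold stdCTSConst; positivity
  have hnn (x : ℝ) : 0 ≤ stdCTSLevyDensity α lp lm x := by
    unfold stdCTSLevyDensity
    split_ifs <;> positivity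
  have hmeas : Measurable (stdCTSLevyDensity α lp lm) := by
    unfold stdCTSLevyDensity
    refine Measurable.ite measurableSet_Ioi (by fun_prop) (Measurable.ite measurableSet_Iio ?_ ?_)
    · fun_prop
    · fun_prop
  rw [stdCTSLevyMeasure, integral_withDensity_eq_integral_toReal_smul (by fun_prop) (by simp)]
  simp_rw [ENNReal.toReal_ofReal (hnn _)]
  obtain ⟨ip, ep⟩ := integral_tempered_stable_Ioi h0 h1 h2 hlp u
  -- Reflecting the negative half-line replaces `u` by `-u`.
  obtain ⟨im, em⟩ := integral_tempered_stable_Ioi h0 h1 h2 hlm (-u)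
  set f : ℝ → ℂ := fun x => stdCTSLevyDensity α lp lm x •
    (Complex.exp (Complex.I * u * x) - 1 - Complex.I * u * x) with hf
  have hfp : ∀ x ∈ Set.Ioi (0 : ℝ), stdCTSConst α lp lm *
      (((Real.exp (-lp * x) / x ^ (1 + α) : ℝ) : ℂ) *
      (Complex.exp (Complex.I * u * x) - 1 - Complex.I * u * x)) = f x := by
    intro x hx
    have hx0 : (0 : ℝ) < x := hx
    simp only [hf, stdCTSLevyDensity, if_pos hx0, Complex.real_smul]
    push_cast
    ring
  have hfm : ∀ x ∈ Set.Ioi (0 : ℝ), stdCTSConst α lp lm *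
      (((Real.exp (-lm * x) / x ^ (1 + α) : ℝ) : ℂ) *
      (Complex.exp (Complex.I * (-u : ℝ) * x) - 1 - Complex.I * (-u : ℝ) * x)) = f (-x) := by
    intro x hx
    have hx0 : (0 : ℝ) < x := hx
    simp only [hf, stdCTSLevyDensity, if_neg (show ¬ (0 < -x) by linarith),
      if_pos (show -x < 0 by linarith), Complex.real_smul, abs_neg, abs_of_pos hx0]
    push_cast
    ring_nf
  have Ip : IntegrableOn f (Set.Ioi 0) :=
    IntegrableOn.congr_fun (Integrable.const_mul ip _) hfp measurableSet_Ioi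
  have Im : IntegrableOn f (Set.Iic 0) := by
    have h : IntegrableOn (fun x => f (-x)) (Set.Ioi 0) :=
      IntegrableOn.congr_fun (Integrable.const_mul im _) hfm measurableSet_Ioi
    rw [integrableOn_Iic_iff_integrableOn_Iio]
    refine ((Measure.measurePreserving_neg (volume : Measure ℝ)).integrableOn_comp_preimage
      (Homeomorph.neg ℝ).measurableEmbedding).1 ?_
    simpa [Function.comp_def] using h
  have Ef : ∫ x, f x = (∫ x in Set.Ioi 0, f (-x)) + ∫ x in Set.Ioi 0, f x := by
    rw [integral_comp_neg_Ioi, neg_zero, intervalIntegral.integral_Iic_add_Ioi Im Ip]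
  rw [Ef, ← setIntegral_congr_fun measurableSet_Ioi hfp,
    ← setIntegral_congr_fun measurableSet_Ioi hfm, integral_const_mul, integral_const_mul, ep, em]
  have e1 : (lp : ℂ) ^ ((α : ℂ) - 2) = ((lp ^ (α - 2) : ℝ) : ℂ) := by
    rw [Complex.ofReal_cpow hlp.le]; push_cast; rfl
  have e2 : (lm : ℂ) ^ ((α : ℂ) - 2) = ((lm ^ (α - 2) : ℝ) : ℂ) := by
    rw [Complex.ofReal_cpow hlm.le]; push_cast; rfl
  have hS' : ((lp ^ (α - 2) : ℝ) : ℂ) + ((lm ^ (α - 2) : ℝ) : ℂ) ≠ 0 := by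
    exact_mod_cast hS.ne'
  have hΓ' : (Real.Gamma (2 - α) : ℂ) ≠ 0 := by exact_mod_cast hΓ.ne'
  have h0' : (α : ℂ) ≠ 0 := by exact_mod_cast h0.ne'
  have h1' : (α : ℂ) - 1 ≠ 0 := sub_ne_zero.2 (by exact_mod_cast h1)
  simp only [stdCTSConst, stdCTSExponent, e1, e2, Complex.ofReal_neg, mul_neg, sub_neg_eq_add,
    Complex.ofReal_div, Complex.ofReal_mul, Complex.ofReal_add, Complex.ofReal_one]
  field_simp
  ring

/-! ### Properties of the exponent -/

theorem IsStdCTS.charFun_eq {α lp lm : ℝ} (h0 : 0 < α) (h1 : α ≠ 1) (h2 : α ≤ 2)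
    (hlp : 0 < lp) (hlm : 0 < lm) {ρ : Measure ℝ} (hρ : IsStdCTS α lp lm ρ) (t : ℝ) :
    charFun ρ t = Complex.exp (stdCTSExponent t lp lm α) := by
  rcases h2.lt_or_eq with h | rfl
  · rw [hρ.2.1 h, integral_stdCTSLevyMeasure h0 h1 h hlp hlm]
  · rw [hρ.2.2 rfl, stdCTSExponent_two, charFun_gaussianReal]
    simp [neg_div]

theorem stdCTSExponent_re_nonpos {α lp lm : ℝ} (h0 : 0 < α) (h1 : α ≠ 1) (h2 : α ≤ 2)
    (hlp : 0 < lp) (hlm : 0 < lm) (u : ℝ) : (stdCTSExponent u lp lm α).re ≤ 0 := by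
  rcases h2.lt_or_eq with h | rfl
  · rw [← integral_stdCTSLevyMeasure h0 h1 h hlp hlm]
    set f : ℝ → ℂ := fun x => Complex.exp (Complex.I * u * x) - 1 - Complex.I * u * x
    by_cases hf : Integrable f (stdCTSLevyMeasure α lp lm)
    · change (RCLike.re (∫ x, f x ∂_) : ℝ) ≤ 0
      rw [← integral_re hf]
      refine integral_nonpos fun x => ?_
      simp [f, Complex.exp_re, Real.cos_le_one]
    -- Integrability need not be checked: otherwise the integral is zero by convention.
    · rw [integral_undef hf, Complex.zero_re]
  · rw [stdCTSExponent_two, show (-(u : ℂ) ^ 2 / 2) = ((-u ^ 2 / 2 : ℝ) : ℂ) by push_cast; ring,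
      Complex.ofReal_re]
    nlinarith [sq_nonneg u]

theorem stdCTSExponent_mul {α lp lm r : ℝ} (hlp : 0 < lp) (hlm : 0 < lm) (hr : 0 < r) (u : ℝ) :
    stdCTSExponent (u * r) (lp * r) (lm * r) α = (r : ℂ) ^ 2 * stdCTSExponent u lp lm α := by
  have hr0 : (r : ℂ) ≠ 0 := by exact_mod_cast hr.ne'
  -- Principal powers split here because multiplying by a positive real leaves the argument
  -- unchanged.
  have key {z : ℂ} (hz : 0 < z.re) (c : ℂ) : (z * r) ^ c = z ^ c * (r : ℂ) ^ c := by
    have hz0 : z ≠ 0 := fun h => by simp [h] at hz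
    rw [Complex.cpow_def_of_ne_zero (mul_ne_zero hz0 hr0), Complex.cpow_def_of_ne_zero hz0,
      Complex.cpow_def_of_ne_zero hr0, Complex.log_mul_ofReal _ hr _ hz0, Complex.ofReal_log hr.le,
      ← Complex.exp_add]
    congr 1
    ring
  have a1 : ((lp * r : ℝ) : ℂ) - Complex.I * (u * r : ℝ) = (lp - Complex.I * u) * r := by
    push_cast; ring
  have a2 : ((lm * r : ℝ) : ℂ) + Complex.I * (u * r : ℝ) = (lm + Complex.I * u) * r := by
    push_cast; ring
  have e2 : (r : ℂ) ^ (α : ℂ) = (r : ℂ) ^ ((α : ℂ) - 2) * (r : ℂ) ^ 2 := by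
    rw [Complex.cpow_sub _ _ hr0, Complex.cpow_ofNat]; field_simp
  have e1 : (r : ℂ) ^ ((α : ℂ) - 1) = (r : ℂ) ^ ((α : ℂ) - 2) * r := by
    rw [Complex.cpow_sub _ _ hr0, Complex.cpow_sub _ _ hr0, Complex.cpow_ofNat, Complex.cpow_one]
    field_simp
  have hp : (r : ℂ) ^ ((α : ℂ) - 2) ≠ 0 := by simp [Complex.cpow_eq_zero_iff, hr0]
  simp only [stdCTSExponent, a1, a2]
  simp only [Complex.ofReal_mul, key (z := (lp : ℂ)) (by simpa), key (z := (lm : ℂ)) (by simpa),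
    key (z := (lp - Complex.I * u : ℂ)) (by simpa), key (z := (lm + Complex.I * u : ℂ)) (by simpa)]
  rw [e1, e2]
  set p := (r : ℂ) ^ ((α : ℂ) - 2)
  rw [mul_add ((r : ℂ) ^ 2), ← mul_div_assoc ((r : ℂ) ^ 2), ← mul_div_assoc ((r : ℂ) ^ 2)]
  congr 1
  · refine Eq.trans ?_ (mul_div_mul_right _ _ hp)
    congr 1 <;> ring
  · refine Eq.trans ?_ (mul_div_mul_right _ _ hp)
    congr 1 <;> ring

/-! ### Nonvanishing transforms of infinitely divisible laws -/

theorem integral_map_sum_pi_of_map_sum {𝕜 : Type*} [RCLike 𝕜] {f : ℝ → 𝕜} (hf : Continuous f)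
    {n : ℕ} (hsum : ∀ x : Fin n → ℝ, f (∑ i, x i) = ∏ i, f (x i)) (ν : Measure ℝ)
    [IsProbabilityMeasure ν] :
    ∫ x, f x ∂((Measure.pi (fun _ : Fin n => ν)).map (fun x => ∑ i, x i)) = (∫ x, f x ∂ν) ^ n := by
  rw [integral_map (by fun_prop) hf.aestronglyMeasurable]
  simp_rw [hsum]
  rw [integral_fintype_prod_eq_pow, Fintype.card_fin]

theorem ae_nonneg_of_map_sum_pi {n : ℕ} (hn : 1 ≤ n) {ν : Measure ℝ} [IsProbabilityMeasure ν]
    (h : ∀ᵐ x ∂((Measure.pi (fun _ : Fin n => ν)).map (fun x => ∑ i, x i)), 0 ≤ x) :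
    ∀ᵐ x ∂ν, 0 ≤ x := by
  have : NeZero n := ⟨by omega⟩
  rw [ae_map_iff (by fun_prop) measurableSet_Ici, ae_iff] at h
  -- If `ν` charged the negative half-line, all summands would be negative together with positive
  -- probability.
  have hsub : Set.univ.pi (fun _ : Fin n => Set.Iio (0 : ℝ)) ⊆ {x | ¬ 0 ≤ ∑ i, x i} := by
    intro x hx
    rw [Set.mem_ofPred_eq, not_le]
    exact Finset.sum_neg (fun i _ => hx i (Set.mem_univ i)) Finset.univ_nonempty
  have h0 := measure_mono_null hsub h
  rw [Measure.pi_pi, Finset.prod_const, pow_eq_zero_iff (by simp; omega)] at h0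
  rw [ae_iff]
  convert! h0 using 2
  ext x
  simp

/-- The left side is at most `2` and at most `2 * ‖z‖ * x`, hence at most `(2 + 2 * ‖z‖) * (x / (1 +
x))`; then use `exp (-x) ≤ 1 / (1 + x)`. The constant does not depend on the law, so it serves all
convolution roots at once. -/
theorem norm_one_sub_cexp_mul_le {z : ℂ} (hz : z.re ≤ 0) {x : ℝ} (hx : 0 ≤ x) :
    ‖1 - Complex.exp (z * x)‖ ≤ (2 + 2 * ‖z‖) * (1 - Real.exp (-x)) := by
  have hx1 : 0 < 1 + x := by linarith
  have hE : x / (1 + x) ≤ 1 - Real.exp (-x) := by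
    have h : Real.exp (-x) ≤ (1 + x)⁻¹ := by
      rw [Real.exp_neg]
      exact inv_anti₀ hx1 (by linarith [Real.add_one_le_exp x])
    have : x / (1 + x) = 1 - (1 + x)⁻¹ := by field_simp; ring
    linarith
  have h2 : ‖1 - Complex.exp (z * x)‖ ≤ 2 := by
    have h : ‖Complex.exp (z * x)‖ ≤ 1 := by
      rw [Complex.norm_exp, Real.exp_le_one_iff]
      simpa using mul_nonpos_of_nonpos_of_nonneg hz hx
    calc _ ≤ ‖(1 : ℂ)‖ + ‖Complex.exp (z * x)‖ := norm_sub_le _ _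
      _ ≤ 2 := by rw [norm_one]; linarith
  have hn : ‖z * x‖ = ‖z‖ * x := by rw [norm_mul, Complex.norm_of_nonneg hx]
  have h3 : ‖1 - Complex.exp (z * x)‖ ≤ 2 * (‖z‖ * x) := by
    rcases le_total ‖z * x‖ 1 with h | h
    · rw [← hn, norm_sub_rev]
      exact Complex.norm_exp_sub_one_le h
    · rw [hn] at h
      linarith
  have h4 : ‖1 - Complex.exp (z * x)‖ ≤ (2 + 2 * ‖z‖) * (x / (1 + x)) := by
    rw [← mul_div_assoc, le_div_iff₀ hx1]
    nlinarith
  exact h4.trans (mul_le_mul_of_nonneg_left hE (by positivity))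

theorem integrable_cexp_mul_of_re_nonpos {Ω : Type*} [MeasurableSpace Ω] {P : Measure Ω}
    [IsFiniteMeasure P] {V : Ω → ℝ} (hV : AEMeasurable V P) (h0 : ∀ᵐ ω ∂P, 0 ≤ V ω) {z : ℂ}
    (hz : z.re ≤ 0) : Integrable (fun ω => Complex.exp (z * V ω)) P := by
  refine Integrable.of_bound (by fun_prop) 1 ?_
  filter_upwards [h0] with ω hω
  rw [Complex.norm_exp, Real.exp_le_one_iff]
  simpa using mul_nonpos_of_nonpos_of_nonneg hz hω

/-- The Laplace transform of the `n`-th root at `1` is `c ^ (1 / n)`, which tends to one. For large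
`n` the root's transform at `z` is therefore within distance less than one of `1`, so it and its
`n`-th power are nonzero. -/
theorem IsInfinitelyDivisible.complexMGF_id_ne_zero {ρ : Measure ℝ} [IsProbabilityMeasure ρ]
    (hρ : IsInfinitelyDivisible ρ) (h0 : ∀ᵐ x ∂ρ, 0 ≤ x) {z : ℂ} (hz : z.re ≤ 0) :
    complexMGF id ρ z ≠ 0 := by
  have hint (m : Measure ℝ) [IsProbabilityMeasure m] (hm : ∀ᵐ x ∂m, 0 ≤ x) :
      Integrable (fun x => Real.exp (-x)) m := by
    refine Integrable.of_bound (by fun_prop) 1 ?_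
    filter_upwards [hm] with x hx
    simpa using hx
  set c := ∫ x, Real.exp (-x) ∂ρ with hc
  have hcpos : 0 < c := integral_exp_pos (hint ρ h0)
  have hlim : Filter.Tendsto (fun n : ℕ => (2 + 2 * ‖z‖) * (1 - c ^ ((n : ℝ)⁻¹))) Filter.atTop
      (nhds 0) := by
    have h1 : Filter.Tendsto (fun n : ℕ => c ^ ((n : ℝ)⁻¹)) Filter.atTop (nhds (c ^ (0 : ℝ))) :=
      (Real.continuous_const_rpow hcpos.ne').continuousAt.tendsto.comp
        tendsto_inv_atTop_nhds_zero_nat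
    simpa using (h1.const_sub 1).const_mul (2 + 2 * ‖z‖)
  obtain ⟨n, hn, hn1⟩ := ((hlim.eventually_lt_const one_pos).and
    (Filter.eventually_ge_atTop 1)).exists
  obtain ⟨ν, hν, hρν⟩ := hρ n hn1
  have hν0 : ∀ᵐ x ∂ν, 0 ≤ x := ae_nonneg_of_map_sum_pi hn1 (hρν ▸ h0)
  have hcn : (∫ x, Real.exp (-x) ∂ν) = c ^ ((n : ℝ)⁻¹) := by
    rw [hc, hρν, integral_map_sum_pi_of_map_sum (f := fun x => Real.exp (-x)) (by fun_prop)
      (fun x => by rw [← Finset.sum_neg_distrib, Real.exp_sum]),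
      Real.pow_rpow_inv_natCast (integral_nonneg fun x => (Real.exp_pos _).le) (by omega)]
  have hpow : complexMGF id ρ z = (∫ x : ℝ, Complex.exp (z * x) ∂ν) ^ n := by
    rw [complexMGF, hρν]
    exact integral_map_sum_pi_of_map_sum (f := fun x : ℝ => Complex.exp (z * x)) (by fun_prop)
      (fun x => by rw [Complex.ofReal_sum, Finset.mul_sum, Complex.exp_sum]) ν
  rw [hpow]
  refine pow_ne_zero _ fun hzero => ?_
  have hle : ‖∫ x : ℝ, (1 - Complex.exp (z * x)) ∂ν‖
      ≤ ∫ x, (2 + 2 * ‖z‖) * (1 - Real.exp (-x)) ∂ν := by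
    refine norm_integral_le_of_norm_le (((integrable_const 1).sub (hint ν hν0)).const_mul _) ?_
    filter_upwards [hν0] with x hx using norm_one_sub_cexp_mul_le hz hx
  rw [integral_sub (integrable_const 1)
      (integrable_cexp_mul_of_re_nonpos (V := fun x => x) (by fun_prop) hν0 hz),
    hzero, integral_const_mul, integral_sub (integrable_const 1) (hint ν hν0), hcn] at hle
  simp at hle
  linarith

theorem IsInfinitelyDivisible.complexMGF_ne_zero {Ω : Type*} [MeasurableSpace Ω] {P : Measure Ω}
    [IsProbabilityMeasure P] {V : Ω → ℝ} (hV : AEMeasurable V P)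
    (hdiv : IsInfinitelyDivisible (P.map V)) (h0 : ∀ᵐ ω ∂P, 0 ≤ V ω) {z : ℂ} (hz : z.re ≤ 0) :
    complexMGF V P z ≠ 0 := by
  have := Measure.isProbabilityMeasure_map hV
  rw [← complexMGF_id_map hV]
  exact hdiv.complexMGF_id_ne_zero ((ae_map_iff hV measurableSet_Ici).2 h0) hz

/-! ### Conditioning on the mixing variables -/

/-- Disintegration of an integral along a conditional distribution. -/
theorem integral_prodMk_eq_integral_condDistrib {Ω α β : Type*} [MeasurableSpace Ω]
    [MeasurableSpace α] [MeasurableSpace β] [StandardBorelSpace β] [Nonempty β] {P : Measure Ω}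
    [IsFiniteMeasure P] {T : Ω → α} {W : Ω → β} (hT : Measurable T) (hW : Measurable W)
    {F : α × β → ℂ} (hF : Measurable F) (hint : Integrable (fun ω => F (T ω, W ω)) P) :
    ∫ ω, F (T ω, W ω) ∂P = ∫ ω, ∫ x, F (T ω, x) ∂(condDistrib W T P (T ω)) ∂P := by
  have hTW : AEMeasurable (fun ω => (T ω, W ω)) P := (hT.prodMk hW).aemeasurable
  have h1 : ∫ ω, F (T ω, W ω) ∂P = ∫ p, F p ∂(P.map fun ω => (T ω, W ω)) :=
    (integral_map hTW hF.aestronglyMeasurable).symm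
  have h2 : Integrable F (P.map T ⊗ₘ condDistrib W T P) := by
    rw [compProd_map_condDistrib hW.aemeasurable]
    exact (integrable_map_measure hF.aestronglyMeasurable hTW).2 hint
  rw [h1, ← compProd_map_condDistrib hW.aemeasurable, Measure.integral_compProd h2,
    integral_map hT.aemeasurable]
  exact hF.stronglyMeasurable.integral_kernel_prod_right'.aestronglyMeasurable

theorem integral_cexp_eq_charFun_map {β : Type*} [MeasurableSpace β] (κ : Measure β) {f : β → ℝ}
    (hf : Measurable f) (t : ℝ) :
    ∫ x, Complex.exp (Complex.I * t * f x) ∂κ = charFun (κ.map f) t := by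
  rw [charFun_apply_real, integral_map hf.aemeasurable (by fun_prop)]
  congr with x
  ring_nf

namespace IsMultivariateMixedTS

variable {Ω : Type*} [MeasurableSpace Ω] {P : Measure Ω} [IsProbabilityMeasure P]
  {N : ℕ} {μ β a α lp lm : Fin N → ℝ} {G : Fin N → Ω → ℝ} {Z : Ω → ℝ} {X : Fin N → Ω → ℝ}
  {Y : Ω → EuclideanSpace ℝ (Fin N)}

/-- The conditional characteristic function of `√(V i) * X i` given the mixing variables. -/
theorem ae_condDistrib_charFun (hY : IsMultivariateMixedTS P μ β a α lp lm G Z X Y)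
    (hα : ∀ h, α h ≠ 1) (u : Fin N → ℝ) (i : Fin N) :
    ∀ᵐ ω ∂P, charFun ((condDistrib (fun ω i => X i ω) (fun ω => ((fun i => G i ω), Z ω)) P
        ((fun i => G i ω), Z ω)).map (fun x => x i)) (u i * √(G i ω + a i * Z ω))
      = Complex.exp ((G i ω + a i * Z ω : ℝ) * stdCTSExponent (u i) (lp i) (lm i) (α i)) := by
  filter_upwards [hY.cond_law i, hY.G_nonneg i, hY.Z_nonneg] with ω hω hG hZ
  have hV : 0 ≤ G i ω + a i * Z ω := add_nonneg hG (mul_nonneg (hY.a_nonneg i) hZ)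
  -- Where `V = 0` the conditional law is unspecified, but both sides equal one.
  rcases hV.eq_or_lt with h | h
  · have := Measure.isProbabilityMeasure_map (μ := condDistrib (fun ω i => X i ω)
      (fun ω => ((fun i => G i ω), Z ω)) P ((fun i => G i ω), Z ω))
      (measurable_pi_apply i).aemeasurable
    simp [← h]
  · have hr := Real.sqrt_pos.2 h
    rw [(hω h).charFun_eq (hY.alpha_pos i) (hα i) (hY.alpha_le_two i)
      (mul_pos (hY.lp_pos i) hr) (mul_pos (hY.lm_pos i) hr),
      stdCTSExponent_mul (hY.lp_pos i) (hY.lm_pos i) hr, ← Complex.ofReal_pow, Real.sq_sqrt hV]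

theorem aemeasurable (hY : IsMultivariateMixedTS P μ β a α lp lm G Z X Y) : AEMeasurable Y P := by
  have := hY.measurable_G
  have := hY.measurable_Z
  have := hY.measurable_X
  refine ⟨fun ω => WithLp.toLp 2 fun i =>
    μ i + β i * (G i ω + a i * Z ω) + √(G i ω + a i * Z ω) * X i ω, by fun_prop, ?_⟩
  filter_upwards [hY.Y_eq] with ω hω
  ext i
  exact hω i

/-- The characteristic function after integrating out `X` conditionally on `G` and `Z`. -/
theorem charFun_eq_integral (hY : IsMultivariateMixedTS P μ β a α lp lm G Z X Y)
    (hα : ∀ h, α h ≠ 1) (u : EuclideanSpace ℝ (Fin N)) :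
    charFun (P.map Y) u = ∫ ω, Complex.exp (Complex.I * ∑ h, (u h : ℂ) * μ h) *
      Complex.exp (∑ h, (Complex.I * u h * β h + stdCTSExponent (u h) (lp h) (lm h) (α h)) *
        (G h ω + a h * Z ω : ℝ)) ∂P := by
  have mG := hY.measurable_G
  have mZ := hY.measurable_Z
  have mX := hY.measurable_X
  set A : (Fin N → ℝ) × ℝ → ℂ := fun t =>
    Complex.exp (Complex.I * ∑ h, (u h : ℂ) * (μ h + β h * (t.1 h + a h * t.2))) with hA
  set F : ((Fin N → ℝ) × ℝ) × (Fin N → ℝ) → ℂ := fun p =>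
    A p.1 * ∏ h, Complex.exp (Complex.I * (u h * √(p.1.1 h + a h * p.1.2) : ℝ) * p.2 h) with hF
  have hFm : Measurable F := by fun_prop
  have hFint : Integrable (fun ω => F (((fun i => G i ω), Z ω), fun i => X i ω)) P := by
    -- Every exponent is purely imaginary.
    refine Integrable.of_bound (by fun_prop) 1 (Filter.Eventually.of_forall fun ω => ?_)
    simp [hF, hA, Complex.norm_exp]
  have h1 : charFun (P.map Y) u = ∫ ω, F (((fun i => G i ω), Z ω), fun i => X i ω) ∂P := by
    rw [charFun_apply, integral_map hY.aemeasurable (by fun_prop)]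
    refine integral_congr_ae ?_
    filter_upwards [hY.Y_eq] with ω hω
    simp only [hF, hA]
    rw [← Complex.exp_sum, ← Complex.exp_add, PiLp.inner_apply, Finset.mul_sum,
      ← Finset.sum_add_distrib, Complex.ofReal_sum, Finset.sum_mul]
    congr 1
    refine Finset.sum_congr rfl fun i _ => ?_
    rw [hω i]
    simp
    ring
  rw [h1, integral_prodMk_eq_integral_condDistrib (T := fun ω => ((fun i => G i ω), Z ω))
    (W := fun ω i => X i ω) (by fun_prop) (by fun_prop) hFm hFint]
  refine integral_congr_ae ?_
  filter_upwards [hY.cond_indep, ae_all_iff.2 (hY.ae_condDistrib_charFun hα u)] with ω hind hchar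
  simp only [hF]
  rw [integral_const_mul, hind.integral_fun_prod_comp
    (f := fun h (x : ℝ) => Complex.exp (Complex.I * (u h * √(G h ω + a h * Z ω) : ℝ) * x))
    (fun i => (measurable_pi_apply i).aemeasurable) (fun i => by fun_prop)]
  have hfac (i : Fin N) := (integral_cexp_eq_charFun_map (condDistrib (fun ω i => X i ω)
    (fun ω => ((fun i => G i ω), Z ω)) P ((fun i => G i ω), Z ω)) (measurable_pi_apply i)
    (u i * √(G i ω + a i * Z ω))).trans (hchar i)
  rw [Finset.prod_congr rfl fun i _ => hfac i]
  simp only [hA]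
  rw [← Complex.exp_sum, ← Complex.exp_add, ← Complex.exp_add, Finset.mul_sum, Finset.mul_sum,
    ← Finset.sum_add_distrib, ← Finset.sum_add_distrib]
  congr 1
  refine Finset.sum_congr rfl fun i _ => ?_
  push_cast
  ring

theorem integral_cexp_sum_eq_prod (hY : IsMultivariateMixedTS P μ β a α lp lm G Z X Y)
    (z : Fin N → ℂ) :
    ∫ ω, Complex.exp (∑ h, z h * (G h ω + a h * Z ω : ℝ)) ∂P
      = complexMGF Z P (∑ h, a h * z h) * ∏ h, complexMGF (G h) P (z h) := by
  have mG := hY.measurable_G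
  have mZ := hY.measurable_Z
  have h := hY.indep.integral_fun_prod_comp
    -- The index `none` carries `Z`, whose coefficient collects its contributions to all the `V h`.
    (f := fun (j : Option (Fin N)) (x : ℝ) => Complex.exp (j.elim (∑ h, a h * z h) z * x))
    (fun j => by cases j <;> simp <;> fun_prop) (fun j => by fun_prop)
  simp only [Fintype.prod_option, Option.elim] at h
  refine Eq.trans (integral_congr_ae (Filter.Eventually.of_forall fun ω => ?_)) h
  simp only
  rw [← Complex.exp_sum, ← Complex.exp_add, Finset.sum_mul, ← Finset.sum_add_distrib]
  congr 1
  refine Finset.sum_congr rfl fun i _ => ?_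
  push_cast
  ring

end IsMultivariateMixedTS

theorem mainTheorem4 {Ω : Type*} [MeasurableSpace Ω] (P : Measure Ω) [IsProbabilityMeasure P]
    {N : ℕ} (μ β a α lp lm : Fin N → ℝ) (G : Fin N → Ω → ℝ) (Z : Ω → ℝ) (X : Fin N → Ω → ℝ)
    (Y : Ω → EuclideanSpace ℝ (Fin N))
    (hY : IsMultivariateMixedTS P μ β a α lp lm G Z X Y)
    -- the closed form of the exponent has the factor `α - 1` in its denominators
    (hα : ∀ h, α h ≠ 1) :
    -- `L_stdCTS` is the characteristic exponent of the standardized CTS law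
    (∀ (h : Fin N) (ρ : Measure ℝ), IsStdCTS (α h) (lp h) (lm h) ρ →
      ∀ t : ℝ, charFun ρ t = Complex.exp (stdCTSExponent t (lp h) (lm h) (α h))) ∧
    ∀ u : EuclideanSpace ℝ (Fin N),
      -- the cumulant functions are well defined at the points where they are evaluated
      (Integrable (fun ω => Complex.exp
          ((∑ h, (Complex.I * a h * u h * β h
            + a h * stdCTSExponent (u h) (lp h) (lm h) (α h))) * Z ω)) P ∧
        complexMGF Z P (∑ h, (Complex.I * a h * u h * β h
            + a h * stdCTSExponent (u h) (lp h) (lm h) (α h))) ≠ 0) ∧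
      (∀ h, Integrable (fun ω => Complex.exp
          ((Complex.I * u h * β h + stdCTSExponent (u h) (lp h) (lm h) (α h)) * G h ω)) P ∧
        complexMGF (G h) P
          (Complex.I * u h * β h + stdCTSExponent (u h) (lp h) (lm h) (α h)) ≠ 0) ∧
      -- the characteristic function
      charFun (P.map Y) u =
        Complex.exp (Complex.I * ∑ h, (u h : ℂ) * μ h)
        * Complex.exp (logMGF P Z (∑ h, (Complex.I * a h * u h * β h
            + a h * stdCTSExponent (u h) (lp h) (lm h) (α h))))
        * ∏ h, Complex.exp (logMGF P (G h)
            (Complex.I * u h * β h + stdCTSExponent (u h) (lp h) (lm h) (α h))) := by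
  have hz (u : EuclideanSpace ℝ (Fin N)) (h : Fin N) :
      (Complex.I * u h * β h + stdCTSExponent (u h) (lp h) (lm h) (α h)).re ≤ 0 := by
    simpa using stdCTSExponent_re_nonpos (hY.alpha_pos h) (hα h) (hY.alpha_le_two h) (hY.lp_pos h)
      (hY.lm_pos h) (u h)
  have hzZ (u : EuclideanSpace ℝ (Fin N)) : (∑ h, (Complex.I * a h * u h * β h
      + a h * stdCTSExponent (u h) (lp h) (lm h) (α h))).re ≤ 0 := by
    rw [Complex.re_sum]
    refine Finset.sum_nonpos fun h _ => ?_
    rw [show Complex.I * a h * u h * β h + a h * stdCTSExponent (u h) (lp h) (lm h) (α h)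
      = a h * (Complex.I * u h * β h + stdCTSExponent (u h) (lp h) (lm h) (α h)) by ring,
      Complex.re_ofReal_mul]
    exact mul_nonpos_of_nonneg_of_nonpos (hY.a_nonneg h) (hz u h)
  refine ⟨fun h ρ hρ t => hρ.charFun_eq (hY.alpha_pos h) (hα h) (hY.alpha_le_two h) (hY.lp_pos h)
    (hY.lm_pos h) t, fun u => ?_⟩
  have hZne := hY.Z_infDiv.complexMGF_ne_zero hY.measurable_Z.aemeasurable hY.Z_nonneg (hzZ u)
  have hGne (h : Fin N) := (hY.G_infDiv h).complexMGF_ne_zero (hY.measurable_G h).aemeasurable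
    (hY.G_nonneg h) (hz u h)
  refine ⟨⟨integrable_cexp_mul_of_re_nonpos hY.measurable_Z.aemeasurable hY.Z_nonneg (hzZ u), hZne⟩,
    fun h => ⟨integrable_cexp_mul_of_re_nonpos (hY.measurable_G h).aemeasurable (hY.G_nonneg h)
      (hz u h), hGne h⟩, ?_⟩
  rw [hY.charFun_eq_integral hα u]
  -- Nonvanishing lets `exp` undo `log`, whatever the branch.
  simp only [logMGF, Complex.exp_log hZne, Complex.exp_log (hGne _)]
  rw [integral_const_mul, mul_assoc, hY.integral_cexp_sum_eq_prod]
  congr 3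
  exact Finset.sum_congr rfl fun h _ => by ring
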